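/- Let $a,b,s,h$ be positive integers with $a,b\ge 2$ and $r=a+b\ge 5$. The bush $\mathcal B_{s,h}(a,b)$ is the $r$-uniform hypergraph with edges $A\cup B_i$ and $B_i\cup A_{i,j}$ ($1\le i\le s$, $1\le j\le h$), where $A$, the sets $B_i$ and the sets $A_{i,j}$ are pairwise disjoint, $|A|=|A_{i,j}|=a$ and $|B_i|=b$. Then for every real $C_0>0$ there exist $n_0>0$ and $C_1>0$ (depending only on $a,b,s,h,C_0$) such that the following holds. If $n>n_0$ and $\mathcal H$ is a family of $r$-element subsets of $[n]=\{1,\dots,n\}$ that contains no copy of $\mathcal B_{s,h}(a,b)$ and satisfies $|\mathcal H|>(s-1)\binom{n}{r-1}-C_0n^{r-2}$, then there are $s-1$ distinct vertices in $[n]$, each of which is contained in at least $\binom{n}{r-1}-C_1n^{r-2}$ members of $\mathcal H$. -/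

import Mathlib

/-- The vertices of the graph bush with parameters `s` and `h`: a center, `s` neighbors of the
center, and `h` further neighbors of each of these. -/
inductive BushVertex (s h : ℕ) : Type
  | center : BushVertex s h
  | mid (i : Fin s) : BushVertex s h
  | leaf (i : Fin s) (j : Fin h) : BushVertex s h

/-- The (oriented) edges of the graph bush: center to `mid i`, and `mid i` to `leaf i j`. -/
inductive BushEdge (s h : ℕ) : BushVertex s h → BushVertex s h → Prop
  | inner (i : Fin s) : BushEdge s h BushVertex.center (BushVertex.mid i)
  | outer (i : Fin s) (j : Fin h) : BushEdge s h (BushVertex.mid i) (BushVertex.leaf i j)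

/-- The graph bush `B_{s,h}`: the star `K_{1,s}` with `h` new vertices joined to each of the `s`
leaves of the star. -/
def graphBush (s h : ℕ) : SimpleGraph (BushVertex s h) :=
  SimpleGraph.fromRel (BushEdge s h)

/-- The part of the bipartition of `B_{s,h}` that contains the center: the vertices at even
distance from the center. -/
def bushCenterPart (s h : ℕ) : Set (BushVertex s h) :=
  {w | w = BushVertex.center ∨ ∃ i j, w = BushVertex.leaf i j}

/-- `F` is an `(a,b)`-blowup of the bipartite graph `T` with parts `U` and `Uᶜ`: the vertices of
`T` are replaced by pairwise disjoint sets, of size `a` for vertices in `U` and of size `b` for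
vertices outside `U`, and the members of `F` are exactly the unions of the two sets that
correspond to the ends of an edge of `T`. -/
def IsBlowup {W α : Type*} [DecidableEq α] (T : SimpleGraph W) (U : Set W) (a b : ℕ)
    (F : Set (Finset α)) : Prop :=
  ∃ P : W → Finset α,
    (∀ w w', w ≠ w' → Disjoint (P w) (P w')) ∧
    (∀ u ∈ U, (P u).card = a) ∧
    (∀ v ∉ U, (P v).card = b) ∧
    F = {e | ∃ u v, u ∈ U ∧ v ∉ U ∧ T.Adj u v ∧ e = P u ∪ P v}

/-- The family `H` contains an `(a,b,s,h)`-bush: some subfamily of `H` is an `(a,b)`-blowup of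
`B_{s,h}` in which the center is replaced by a set of size `a`. -/
def ContainsBush {α : Type*} [DecidableEq α] (H : Finset (Finset α)) (a b s h : ℕ) : Prop :=
  ∃ F : Set (Finset α), F ⊆ (H : Set (Finset α)) ∧
    IsBlowup (graphBush s h) (bushCenterPart s h) a b F

/-- The degree of the vertex `v` in `H`: the number of members of `H` that contain `v`. -/
def vertexDegree {α : Type*} [DecidableEq α] (H : Finset (Finset α)) (v : α) : ℕ :=
  (H.filter (fun e => v ∈ e)).card

/-! The proof is the delta-system method followed by a stability count. Colour the vertices with `r`
colours and pass to a positive proportion of a given subfamily in which every member is rainbow and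
every colour set is either a kernel type or avoided (`exists_homogeneous_subset`). The kernel types
form an intersection-closed family on `r` points. If the subfamily has more than `n.choose (r - 2)`
members, every colour set of size `r - 2` lies in a proper kernel type. Then
`complementary_or_principal` leaves two cases: a complementary pair of sizes `a` and `b`, from which
a bush is built greedily, or a colour all of whose supersets are kernel types, which makes the
vertex of that colour a center. So all but `O(n^(r-2))` members of a bush-free family have a center
(`exists_bound_of_forall_not_isCenter`).

An `a`-set linked to `s` distinct vertices yields a bush, so each `(r-1)`-set `Y` has at most `s -
1` extension centers. The lower bound on `H.card` then forces exactly `s - 1` for all but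
`O(n^(r-2))` sets `Y`. Two such sets sharing `r - 2 ≥ a` vertices have the same centers, so
exchanging one vertex at a time shows that almost all `Y` have the same `s - 1` centers
(`exists_popular_value`). These have almost full degree. -/

/-! ### Greedy disjoint selection. -/

section Greedy

/-- Greedy choice of pairwise disjoint sets, each available outside any small set. -/
theorem exists_pairwise_disjoint_of_avoiding {α ι : Type*} [DecidableEq α] [DecidableEq ι]
    (P : ι → Finset α → Prop) (q K : ℕ) (W₀ : Finset α) (I : Finset ι)
    (hP : ∀ i ∈ I, ∀ W : Finset α, W.card ≤ K → ∃ Z, P i Z ∧ Z.card ≤ q ∧ Disjoint Z W)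
    (hK : W₀.card + I.card * q ≤ K) :
    ∃ Z : ι → Finset α, (∀ i ∈ I, P i (Z i) ∧ (Z i).card ≤ q ∧ Disjoint (Z i) W₀) ∧
      ∀ i ∈ I, ∀ j ∈ I, i ≠ j → Disjoint (Z i) (Z j) := by
  induction I using Finset.induction_on with
  | empty => exact ⟨fun _ => ∅, by simp, by simp⟩
  | insert i I hi ih =>
    rw [Finset.card_insert_of_notMem hi, add_mul, one_mul] at hK
    obtain ⟨Z, hZ, hd⟩ := ih (fun j hj => hP j (Finset.mem_insert_of_mem hj)) (by omega)
    have hU : (W₀ ∪ I.biUnion Z).card ≤ K := by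
      have h1 := Finset.card_union_le W₀ (I.biUnion Z)
      have h2 := Finset.card_biUnion_le_card_mul I Z q (fun j hj => (hZ j hj).2.1)
      omega
    obtain ⟨Y, hY, hYq, hYd⟩ := hP i (Finset.mem_insert_self _ _) _ hU
    rw [Finset.disjoint_union_right, Finset.disjoint_biUnion_right] at hYd
    have hne : ∀ j ∈ I, j ≠ i := fun j hj h => hi (h ▸ hj)
    refine ⟨Function.update Z i Y, ?_, ?_⟩
    · intro j hj
      rcases Finset.mem_insert.1 hj with rfl | hj
      · simpa using ⟨hY, hYq, hYd.1⟩
      · simpa [Function.update_of_ne (hne j hj)] using hZ j hj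
    · intro j hj l hl hjl
      rcases Finset.mem_insert.1 hj with rfl | hj' <;> rcases Finset.mem_insert.1 hl with rfl | hl'
      · exact absurd rfl hjl
      · simpa [Function.update_of_ne (hne l hl')] using hYd.2 l hl'
      · simpa [Function.update_of_ne (hne j hj')] using (hYd.2 j hj').symm
      · simpa [Function.update_of_ne (hne l hl'), Function.update_of_ne (hne j hj')] using
          hd j hj' l hl' hjl

end Greedy

/-! ### Bushes from linked sets. -/

section Bush

variable {α : Type*} [DecidableEq α]

/-- Outside any set of at most `K` vertices there is an `a`-set that completes `B` to a member
of `H`. -/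
def IsExtendable (H : Finset (Finset α)) (a K : ℕ) (B : Finset α) : Prop :=
  ∀ W : Finset α, W.card ≤ K → ∃ A, A.card = a ∧ A ∪ B ∈ H ∧ Disjoint A W

/-- Outside any set of at most `K` vertices, `C` can be enlarged to an extendable `b`-set that
completes `A` to a member of `H`. -/
def IsLinked (H : Finset (Finset α)) (a b K : ℕ) (A C : Finset α) : Prop :=
  ∀ W : Finset α, W.card ≤ K → ∃ B, C ⊆ B ∧ B.card = b ∧ A ∪ B ∈ H ∧ Disjoint A B ∧
    Disjoint (B \ C) W ∧ IsExtendable H a K B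

theorem IsExtendable.mono {G H : Finset (Finset α)} (hGH : G ⊆ H) {a K : ℕ} {B : Finset α}
    (h : IsExtendable G a K B) : IsExtendable H a K B := fun W hW =>
  let ⟨A, h1, h2, h3⟩ := h W hW
  ⟨A, h1, hGH h2, h3⟩

theorem IsLinked.mono {G H : Finset (Finset α)} (hGH : G ⊆ H) {a b K : ℕ} {A C : Finset α}
    (h : IsLinked G a b K A C) : IsLinked H a b K A C := fun W hW =>
  let ⟨B, h1, h2, h3, h4, h5, h6⟩ := h W hW
  ⟨B, h1, h2, hGH h3, h4, h5, h6.mono hGH⟩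

theorem containsBush_of_disjoint {H : Finset (Finset α)} {a b s h : ℕ} {A : Finset α}
    {B : Fin s → Finset α} {L : Fin s × Fin h → Finset α} (hA : A.card = a)
    (hB : ∀ i, (B i).card = b) (hL : ∀ p, (L p).card = a) (hAB : ∀ i, Disjoint A (B i))
    (hBB : ∀ i j, i ≠ j → Disjoint (B i) (B j)) (hAL : ∀ p, Disjoint A (L p))
    (hBL : ∀ i p, Disjoint (B i) (L p)) (hLL : ∀ p q, p ≠ q → Disjoint (L p) (L q))
    (hABH : ∀ i, A ∪ B i ∈ H) (hLBH : ∀ i j, L (i, j) ∪ B i ∈ H) :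
    ContainsBush H a b s h := by
  let P : BushVertex s h → Finset α := fun w => match w with
    | .center => A
    | .mid i => B i
    | .leaf i j => L (i, j)
  refine ⟨{e | ∃ u v, u ∈ bushCenterPart s h ∧ v ∉ bushCenterPart s h ∧
    (graphBush s h).Adj u v ∧ e = P u ∪ P v}, ?_, P, ?_, ?_, ?_, rfl⟩
  · rintro e ⟨u, v, hu, hv, huv, rfl⟩
    rcases huv with ⟨-, huv | huv⟩
    · cases huv with
      | inner i => exact hABH i
      | outer i j => exact absurd (Or.inr ⟨i, j, rfl⟩) hv
    · cases huv with
      | inner i => exact absurd (Or.inl rfl) hv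
      | outer i j => exact hLBH i j
  · rintro (_ | i | ⟨i, j⟩) (_ | i' | ⟨i', j'⟩) hne
    · exact absurd rfl hne
    · exact hAB i'
    · exact hAL (i', j')
    · exact (hAB i).symm
    · exact hBB i i' (fun h => hne (by rw [h]))
    · exact hBL i (i', j')
    · exact (hAL (i, j)).symm
    · exact (hBL i' (i, j)).symm
    · refine hLL (i, j) (i', j') (fun h => hne ?_)
      rw [Prod.mk.injEq] at h
      rw [h.1, h.2]
  · rintro u (rfl | ⟨i, j, rfl⟩)
    · exact hA
    · exact hL (i, j)
  · rintro (_ | i | ⟨i, j⟩) hv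
    · exact absurd (Or.inl rfl) hv
    · exact hB i
    · exact absurd (Or.inr ⟨i, j, rfl⟩) hv

/-- Two greedy rounds: enlarge the cores `C i` to disjoint extendable sets `B i`, then attach
disjoint leaves. The bound on `K` pays for every vertex that has to be avoided. -/
theorem containsBush_of_isLinked {H : Finset (Finset α)} {a b s h K : ℕ}
    (hK : a + s * b + s + s * h * a ≤ K) {A : Finset α} (hA : A.card = a)
    {C : Fin s → Finset α} (hC : ∀ i, (C i).card ≤ 1)
    (hCC : ∀ i j, i ≠ j → Disjoint (C i) (C j)) (hlink : ∀ i, IsLinked H a b K A (C i)) :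
    ContainsBush H a b s h := by
  classical
  -- All cores are forbidden in advance, so that the enlargement of one core cannot meet another.
  have hW₀ : (A ∪ Finset.univ.biUnion C).card ≤ a + s := by
    have h1 := Finset.card_union_le A (Finset.univ.biUnion C)
    have h2 := Finset.card_biUnion_le_card_mul Finset.univ C 1 (fun j _ => hC j)
    simp at h2
    omega
  obtain ⟨Z, hZ, hZZ⟩ := exists_pairwise_disjoint_of_avoiding
    (fun i Z => (C i ∪ Z).card = b ∧ A ∪ (C i ∪ Z) ∈ H ∧ Disjoint A (C i ∪ Z) ∧
      IsExtendable H a K (C i ∪ Z)) b K (A ∪ Finset.univ.biUnion C) (Finset.univ : Finset (Fin s))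
    (by
      intro i _ W hW
      obtain ⟨B, h1, h2, h3, h4, h5, h6⟩ := hlink i W hW
      refine ⟨B \ C i, ?_, ?_, h5⟩
      · rw [Finset.union_sdiff_of_subset h1]
        exact ⟨h2, h3, h4, h6⟩
      · exact h2 ▸ Finset.card_le_card Finset.sdiff_subset)
    (by
      rw [Finset.card_univ, Fintype.card_fin]
      have : 0 ≤ s * h * a := Nat.zero_le _
      omega)
  have hZC : ∀ i j, Disjoint (Z i) (C j) := fun i j => by
    have := (hZ i (Finset.mem_univ _)).2.2
    rw [Finset.disjoint_union_right, Finset.disjoint_biUnion_right] at this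
    exact this.2 j (Finset.mem_univ _)
  set B : Fin s → Finset α := fun i => C i ∪ Z i with hBdef
  have hB : ∀ i, (B i).card = b ∧ A ∪ B i ∈ H ∧ Disjoint A (B i) ∧ IsExtendable H a K (B i) :=
    fun i => (hZ i (Finset.mem_univ _)).1
  have hW₁ : (A ∪ Finset.univ.biUnion B).card ≤ a + s * b := by
    have h1 := Finset.card_union_le A (Finset.univ.biUnion B)
    have h2 := Finset.card_biUnion_le_card_mul Finset.univ B b (fun j _ => (hB j).1.le)
    simp at h2
    omega
  obtain ⟨L, hL, hLL⟩ := exists_pairwise_disjoint_of_avoiding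
    (fun (p : Fin s × Fin h) L => L.card = a ∧ L ∪ B p.1 ∈ H) a K (A ∪ Finset.univ.biUnion B)
    Finset.univ
    (by
      intro p _ W hW
      obtain ⟨L, h1, h2, h3⟩ := (hB p.1).2.2.2 W hW
      exact ⟨L, ⟨h1, h2⟩, h1.le, h3⟩)
    (by
      rw [Finset.card_univ, Fintype.card_prod, Fintype.card_fin, Fintype.card_fin]
      omega)
  have hLW : ∀ p, Disjoint (L p) A ∧ ∀ i, Disjoint (L p) (B i) := fun p => by
    have := (hL p (Finset.mem_univ _)).2.2
    rw [Finset.disjoint_union_right, Finset.disjoint_biUnion_right] at this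
    exact ⟨this.1, fun i => this.2 i (Finset.mem_univ _)⟩
  refine containsBush_of_disjoint (A := A) (B := B) (L := L) hA (fun i => (hB i).1)
    (fun p => (hL p (Finset.mem_univ _)).1.1) (fun i => (hB i).2.2.1) ?_
    (fun p => (hLW p).1.symm) (fun i p => ((hLW p).2 i).symm)
    (fun p q => hLL p (Finset.mem_univ _) q (Finset.mem_univ _)) (fun i => (hB i).2.1)
    (fun i j => (hL (i, j) (Finset.mem_univ _)).1.2)
  intro i j hij
  simp only [hBdef, Finset.disjoint_union_left, Finset.disjoint_union_right]
  exact ⟨⟨hCC i j hij, hZC i j⟩, (hZC j i).symm,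
    hZZ i (Finset.mem_univ _) j (Finset.mem_univ _) hij⟩

end Bush

/-! ### Intersection-closed families of colour sets. -/

section IntersectionTypes

theorem mem_of_forall_exists_subset {ι : Type*} [DecidableEq ι] {U : Set (Finset ι)}
    (h0 : ∅ ∈ U) (hU : ∀ X ∈ U, ∀ Y ∈ U, X ∪ Y ∈ U) {Z : Finset ι}
    (hZ : ∀ v ∈ Z, ∃ F ∈ U, v ∈ F ∧ F ⊆ Z) : Z ∈ U := by
  choose! F hF using hZ
  have : Z.sup F ∈ U :=
    Finset.sup_induction h0 (fun X hX Y hY => hU X hX Y hY) (fun v hv => (hF v hv).1)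
  convert this using 1
  refine le_antisymm (fun v hv => ?_) (Finset.sup_le fun v hv => (hF v hv).2.2)
  exact Finset.mem_sup.2 ⟨v, hv, (hF v hv).2.1⟩

/-- An intersection-closed family covering all sets of corank two contains a complementary pair
of prescribed sizes, or all supersets of a point. -/
theorem complementary_or_principal {a b r : ℕ} (ha : 2 ≤ a) (hb : 2 ≤ b) (hab : r = a + b)
    (hr : 5 ≤ r) {J : Set (Finset (Fin r))} (huniv : Finset.univ ∈ J)
    (hinter : ∀ X ∈ J, ∀ Y ∈ J, X ∩ Y ∈ J)
    (hcov : ∀ X : Finset (Fin r), X.card = r - 2 → ∃ Y ∈ J, Y ≠ Finset.univ ∧ X ⊆ Y) :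
    (∃ X ∈ J, Xᶜ ∈ J ∧ X.card = a) ∨ ∃ c, ∀ X : Finset (Fin r), c ∈ X → X ∈ J := by
  classical
  set D : Finset (Fin r) := Finset.univ.filter (fun i => ({i} : Finset (Fin r))ᶜ ∉ J) with hD
  have hpair : ∀ i ∈ D, ∀ j ∈ D, i ≠ j → ({i, j} : Finset (Fin r))ᶜ ∈ J := by
    intro i hi j hj hij
    rw [hD, Finset.mem_filter] at hi hj
    obtain ⟨Y, hY, hYu, hsub⟩ := hcov ({i, j} : Finset (Fin r))ᶜ (by
      rw [Finset.card_compl, Finset.card_pair hij, Fintype.card_fin])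
    have hsub' : Yᶜ ⊆ {i, j} := by
      rw [← compl_compl ({i, j} : Finset (Fin r))]
      exact Finset.compl_subset_compl.2 hsub
    have hne : Yᶜ ≠ ∅ := by
      rwa [Ne, Finset.compl_eq_empty_iff]
    have hYc : Yᶜ = {i, j} := by
      have hcases : Yᶜ = ∅ ∨ Yᶜ = {j} ∨ Yᶜ = {i} ∨ Yᶜ = {i, j} := by
        generalize Yᶜ = Z at hsub'
        rw [← Finset.mem_powerset] at hsub'
        simpa [Finset.powerset_insert, or_assoc, eq_comm] using hsub'
      rcases hcases with h | h | h | h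
      · exact absurd h hne
      · exact absurd hY (by rw [← compl_compl Y, h]; exact hj.2)
      · exact absurd hY (by rw [← compl_compl Y, h]; exact hi.2)
      · exact h
    rwa [← hYc, compl_compl]
  -- Complements of members of `J` are closed under union and include the singletons outside `D` and
  -- the pairs inside `D`. These pieces cover any `Z` that does not meet `D` in a single point.
  have key : ∀ Z : Finset (Fin r), (Z ∩ D).card ≠ 1 → Zᶜ ∈ J := by
    intro Z hZ
    refine mem_of_forall_exists_subset (U := {Z | Zᶜ ∈ J}) (by simpa using huniv) ?_ ?_
    · intro X hX Y hY
      simp only [Set.mem_ofPred_eq, Finset.compl_union]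
      exact hinter _ hX _ hY
    · intro v hv
      by_cases hvD : v ∈ D
      · have hmem : v ∈ Z ∩ D := Finset.mem_inter.2 ⟨hv, hvD⟩
        have hpos := Finset.card_pos.2 ⟨v, hmem⟩
        obtain ⟨w, hw, hwv⟩ := Finset.exists_mem_ne (by omega : 1 < (Z ∩ D).card) v
        rw [Finset.mem_inter] at hw
        refine ⟨{v, w}, hpair v hvD w hw.2 hwv.symm, by simp, ?_⟩
        intro x hx
        rcases Finset.mem_insert.1 hx with rfl | hx
        · exact hv
        · rw [Finset.mem_singleton.1 hx]; exact hw.1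
      · refine ⟨{v}, ?_, by simp, by simpa using hv⟩
        by_contra hcon
        exact hvD (by rw [hD, Finset.mem_filter]; exact ⟨Finset.mem_univ _, hcon⟩)
  by_cases hd : D.card = 1
  · right
    obtain ⟨c, hc⟩ := Finset.card_eq_one.1 hd
    refine ⟨c, fun X hX => ?_⟩
    have h0 : Xᶜ ∩ D = ∅ := by
      rw [hc]
      ext x
      simp only [Finset.mem_inter, Finset.mem_compl, Finset.mem_singleton, Finset.notMem_empty,
        iff_false]
      rintro ⟨h1, rfl⟩
      exact h1 hX
    have := key Xᶜ (by rw [h0]; simp)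
    rwa [compl_compl] at this
  · left
    have hdr : D.card ≤ r := (Finset.card_le_univ D).trans (by simp)
    -- Here `t` is the size of `X ∩ D`; neither `X` nor its complement may meet `D` in one point.
    -- The hypothesis `5 ≤ r` excludes `a = b = 2` with `D.card = 3`, where no such `t` exists.
    obtain ⟨t, ht1, ht2, ht3, ht4, ht5⟩ : ∃ t, t ≤ a ∧ t ≤ D.card ∧ D.card - t ≤ b ∧ t ≠ 1 ∧
        D.card - t ≠ 1 := by
      rcases Nat.lt_or_ge D.card 4 with h4 | h4
      · by_cases h : D.card ≤ a
        · exact ⟨D.card, by omega⟩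
        · exact ⟨0, by omega⟩
      · by_cases h : D.card - 2 ≤ b
        · exact ⟨2, by omega⟩
        · exact ⟨D.card - b, by omega⟩
    obtain ⟨X₁, hX₁, hc₁⟩ := Finset.exists_subset_card_eq ht2
    obtain ⟨X₂, hX₂, hc₂⟩ := Finset.exists_subset_card_eq
      (show a - t ≤ Dᶜ.card by rw [Finset.card_compl, Fintype.card_fin]; omega)
    have hdis : Disjoint X₂ D := Finset.disjoint_left.2 fun x hx => Finset.mem_compl.1 (hX₂ hx)
    have hXD : (X₁ ∪ X₂) ∩ D = X₁ := by
      rw [Finset.union_inter_distrib_right, Finset.inter_eq_left.2 hX₁,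
        Finset.disjoint_iff_inter_eq_empty.1 hdis, Finset.union_empty]
    have hXcD : (X₁ ∪ X₂)ᶜ ∩ D = D \ X₁ := by
      have hsd := Finset.sdiff_inter_self_right D (X₁ ∪ X₂)
      rw [hXD, Finset.sdiff_eq_inter_compl D (X₁ ∪ X₂)] at hsd
      rw [hsd, Finset.inter_comm]
    refine ⟨X₁ ∪ X₂, ?_, key _ (by rw [hXD, hc₁]; exact ht4), ?_⟩
    · have := key (X₁ ∪ X₂)ᶜ (by rw [hXcD, Finset.card_sdiff_of_subset hX₁, hc₁]; exact ht5)
      rwa [compl_compl] at this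
    · rw [Finset.card_union_of_disjoint, hc₁, hc₂]
      · omega
      · exact (hdis.mono_right hX₁).symm

end IntersectionTypes

/-! ### Homogeneous subfamilies (delta-system method). -/

section Homogeneous

variable {α ι : Type*} [DecidableEq ι]

/-- The vertices of `e` whose colour lies in `X`. -/
def colorPart (χ : α → ι) (X : Finset ι) (e : Finset α) : Finset α :=
  e.filter (fun v => χ v ∈ X)

/-- The part of any `e ∈ H` with colours in `X` extends to members of `H` that avoid, on the
remaining colours, any prescribed set of at most `K` vertices. -/
def IsKernelType (χ : α → ι) (K : ℕ) (H : Finset (Finset α)) (X : Finset ι) : Prop :=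
  ∀ e ∈ H, ∀ W : Finset α, W.card ≤ K → ∃ e' ∈ H, colorPart χ X e' = colorPart χ X e ∧
    ∀ v ∈ e', χ v ∉ X → v ∉ W

/-- No two members of `H` intersect exactly in their common part with colours in `X`. -/
def IsAvoidedType (χ : α → ι) (H : Finset (Finset α)) (X : Finset ι) : Prop :=
  ∀ e ∈ H, ∀ e' ∈ H, colorPart χ X e = colorPart χ X e' → ∃ v, v ∈ e ∧ v ∈ e' ∧ χ v ∉ X

theorem IsAvoidedType.mono {χ : α → ι} {G H : Finset (Finset α)} (hGH : G ⊆ H) {X : Finset ι}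
    (h : IsAvoidedType χ H X) : IsAvoidedType χ G X :=
  fun e he e' he' => h e (hGH he) e' (hGH he')

variable [DecidableEq α]

/-- No part with colours in `X` of a member of `H` is the kernel of an unavoidable family. -/
def IsCoveredType (χ : α → ι) (K : ℕ) (H : Finset (Finset α)) (X : Finset ι) : Prop :=
  ∀ D : Finset α, ∃ W : Finset α, W.card ≤ K ∧ ∀ e ∈ H, colorPart χ X e = D →
    ∃ v ∈ e, χ v ∉ X ∧ v ∈ W

/-- Repeatedly deleting all members with a common non-kernel part. -/
theorem exists_isKernelType_of_deletion (χ : α → ι) (K : ℕ) (J : Finset (Finset ι))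
    (H : Finset (Finset α)) :
    ∃ H₀ ⊆ H, (∀ X ∈ J, IsKernelType χ K H₀ X) ∧ ∃ G : Finset ι → Finset (Finset α),
      (∀ X ∈ J, G X ⊆ H ∧ IsCoveredType χ K (G X) X) ∧ H ⊆ H₀ ∪ J.biUnion G := by
  classical
  induction H using Finset.strongInduction with
  | H H ih =>
  by_cases hH : ∀ X ∈ J, IsKernelType χ K H X
  · exact ⟨H, subset_rfl, hH, fun _ => ∅, by simp [IsCoveredType]; exact fun _ _ => ⟨∅, by simp⟩,
      Finset.subset_union_left⟩
  simp only [IsKernelType] at hH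
  push Not at hH
  obtain ⟨X, hX, e, he, W, hW, hcov⟩ := hH
  -- The single set `W` blocks this whole fibre, so the fibre can be moved into `G X` while keeping
  -- `G X` covered.
  set Q := H.filter (fun e' => colorPart χ X e' = colorPart χ X e) with hQ
  have hss : H \ Q ⊂ H := Finset.sdiff_ssubset (Finset.filter_subset _ _)
    ⟨e, Finset.mem_filter.2 ⟨he, rfl⟩⟩
  obtain ⟨H₀, hH₀, hker, G, hG, hsub⟩ := ih _ hss
  refine ⟨H₀, hH₀.trans hss.subset, hker, Function.update G X (G X ∪ Q), ?_, ?_⟩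
  · intro Y hY
    by_cases hYX : Y = X
    · subst hYX
      rw [Function.update_self]
      refine ⟨Finset.union_subset ((hG Y hY).1.trans hss.subset) (Finset.filter_subset _ _),
        fun D => ?_⟩
      by_cases hD : D = colorPart χ Y e
      · refine ⟨W, hW, fun e' he' heD => ?_⟩
        have heH : e' ∈ H := by
          rcases Finset.mem_union.1 he' with h | h
          · exact hss.subset ((hG Y hY).1 h)
          · exact Finset.filter_subset _ _ h
        exact hcov e' heH (heD.trans hD)
      · obtain ⟨W', hW', h'⟩ := (hG Y hY).2 D
        refine ⟨W', hW', fun e' he' heD => ?_⟩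
        rcases Finset.mem_union.1 he' with h | h
        · exact h' e' h heD
        · exact absurd (heD.symm.trans (Finset.mem_filter.1 h).2) hD
    · rw [Function.update_of_ne hYX]
      exact ⟨(hG Y hY).1.trans hss.subset, (hG Y hY).2⟩
  · intro f hf
    by_cases hfQ : f ∈ Q
    · refine Finset.mem_union_right _ (Finset.mem_biUnion.2 ⟨X, hX, ?_⟩)
      rw [Function.update_self]
      exact Finset.mem_union_right _ hfQ
    · rcases Finset.mem_union.1 (hsub (Finset.mem_sdiff.2 ⟨hf, hfQ⟩)) with h | h
      · exact Finset.mem_union_left _ h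
      · obtain ⟨Y, hY, hfY⟩ := Finset.mem_biUnion.1 h
        refine Finset.mem_union_right _ (Finset.mem_biUnion.2 ⟨Y, hY, ?_⟩)
        by_cases hYX : Y = X
        · subst hYX
          rw [Function.update_self]
          exact Finset.mem_union_left _ hfY
        · rwa [Function.update_of_ne hYX]

/-- In each fibre of `colorPart χ X`, by pigeonhole, some blocking vertex coloured outside `X` lies
in a `1/K` proportion of the members. Keeping only those gives any two of them a common vertex
outside `X`. -/
theorem exists_isAvoidedType_of_isCoveredType {χ : α → ι} {K : ℕ} {H : Finset (Finset α)}
    {X : Finset ι} (h : IsCoveredType χ K H X) :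
    ∃ G ⊆ H, H.card ≤ K * G.card ∧ IsAvoidedType χ G X := by
  classical
  have hpick : ∀ D : Finset α, ∃ w ⊆ H.filter (colorPart χ X · = D),
      (H.filter (colorPart χ X · = D)).card ≤ K * w.card ∧
      ∀ e ∈ w, ∀ e' ∈ w, ∃ v, v ∈ e ∧ v ∈ e' ∧ χ v ∉ X := by
    intro D
    obtain ⟨W, hWK, hW⟩ := h D
    set Q := H.filter (colorPart χ X · = D) with hQ
    rcases Q.eq_empty_or_nonempty with h0 | hne
    · exact ⟨∅, Finset.empty_subset _, by simp [h0], by simp⟩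
    set W' := W.filter (fun v => χ v ∉ X) with hW'
    have hcover : Q ⊆ W'.biUnion (fun v => Q.filter (v ∈ ·)) := by
      intro e he
      obtain ⟨v, hve, hvX, hvW⟩ := hW e (Finset.mem_filter.1 he).1 (Finset.mem_filter.1 he).2
      exact Finset.mem_biUnion.2 ⟨v, Finset.mem_filter.2 ⟨hvW, hvX⟩,
        Finset.mem_filter.2 ⟨he, hve⟩⟩
    have hW'K : W'.card ≤ K := (Finset.card_le_card (Finset.filter_subset _ _)).trans hWK
    have hW'ne : W'.Nonempty := by
      obtain ⟨e, he⟩ := hne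
      obtain ⟨v, hv, -⟩ := Finset.mem_biUnion.1 (hcover he)
      exact ⟨v, hv⟩
    obtain ⟨v, hv, hvQ⟩ : ∃ v ∈ W', Q.card ≤ K * (Q.filter (v ∈ ·)).card := by
      refine Finset.exists_le_of_sum_le hW'ne ?_
      rw [Finset.sum_const, smul_eq_mul, ← Finset.mul_sum]
      exact Nat.mul_le_mul hW'K ((Finset.card_le_card hcover).trans Finset.card_biUnion_le)
    exact ⟨Q.filter (v ∈ ·), Finset.filter_subset _ _, hvQ, fun e he e' he' =>
      ⟨v, (Finset.mem_filter.1 he).2, (Finset.mem_filter.1 he').2, (Finset.mem_filter.1 hv).2⟩⟩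
  choose w hwQ hwK hw using hpick
  have hwD : ∀ D, ∀ e ∈ w D, e ∈ H ∧ colorPart χ X e = D := fun D e he =>
    Finset.mem_filter.1 (hwQ D he)
  refine ⟨(H.image (colorPart χ X)).biUnion w, ?_, ?_, ?_⟩
  · exact Finset.biUnion_subset.2 fun D _ e he => (hwD D e he).1
  · rw [Finset.card_biUnion, Finset.card_eq_sum_card_image (colorPart χ X) H, Finset.mul_sum]
    · exact Finset.sum_le_sum fun D _ => hwK D
    · intro D _ D' _ hne
      exact Finset.disjoint_left.2 fun e he he' =>
        hne ((hwD D e he).2.symm.trans (hwD D' e he').2)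
  · intro e he e' he' hee
    obtain ⟨D, -, heD⟩ := Finset.mem_biUnion.1 he
    obtain ⟨D', -, heD'⟩ := Finset.mem_biUnion.1 he'
    have : D = D' := (hwD D e heD).2.symm.trans (hee.trans (hwD D' e' heD').2)
    subst this
    exact hw D e heD e' heD'

/-- Every family has a proportion of members forming a subfamily in which each colour type is
either a kernel type or avoided. -/
theorem exists_homogeneous_subset (ι : Type*) [DecidableEq ι] (K m : ℕ) : ∃ M : ℕ,
    ∀ (α : Type) [DecidableEq α] (χ : α → ι) (J : Finset (Finset ι)) (H : Finset (Finset α)),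
    J.card = m → (∀ X ∉ J, IsAvoidedType χ H X) →
    ∃ G ⊆ H, H.card ≤ M * G.card ∧ ∃ J' ⊆ J, (∀ X ∈ J', IsKernelType χ K G X) ∧
      ∀ X ∉ J', IsAvoidedType χ G X := by
  classical
  induction m with
  | zero =>
    refine ⟨1, fun α _ χ J H hJ hH => ⟨H, subset_rfl, by simp, J, subset_rfl, ?_, hH⟩⟩
    rw [Finset.card_eq_zero.1 hJ]
    simp
  | succ m ih =>
    obtain ⟨M, hM⟩ := ih
    refine ⟨(m + 2) * (K * M) + (m + 2), fun α _ χ J H hJ hH => ?_⟩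
    obtain ⟨H₀, hH₀, hker, G, hG, hsub⟩ := exists_isKernelType_of_deletion χ K J H
    -- One of the `m + 2` pieces `H₀`, `G X` is large. Avoidance passes to subfamilies but being a
    -- kernel type does not, so types are made avoided one by one, and the remaining ones become
    -- kernel types simultaneously when `H₀` is large.
    by_cases hbig : H.card ≤ (m + 2) * H₀.card
    · exact ⟨H₀, hH₀, hbig.trans (Nat.mul_le_mul_right _ (Nat.le_add_left _ _)), J, subset_rfl,
        hker, fun X hX => (hH X hX).mono hH₀⟩
    obtain ⟨X, hX, hGX⟩ : ∃ X ∈ J, H.card ≤ (m + 2) * (G X).card := by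
      by_contra! hcon
      have h1 : H.card ≤ H₀.card + ∑ X ∈ J, (G X).card :=
        (Finset.card_le_card hsub).trans ((Finset.card_union_le _ _).trans
          (Nat.add_le_add_left Finset.card_biUnion_le _))
      have h2 : ∑ X ∈ J, (m + 2) * (G X).card ≤ J.card * H.card := by
        rw [← smul_eq_mul]
        exact Finset.sum_le_card_nsmul _ _ _ fun X hX => (hcon X hX).le
      rw [← Finset.mul_sum, hJ] at h2
      nlinarith
    obtain ⟨G₁, hG₁, hG₁K, hG₁X⟩ := exists_isAvoidedType_of_isCoveredType (hG X hX).2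
    have hG₁H : G₁ ⊆ H := hG₁.trans (hG X hX).1
    obtain ⟨G₂, hG₂, hG₂M, J', hJ', h1, h2⟩ := hM α χ (J.erase X) G₁
      (by rw [Finset.card_erase_of_mem hX, hJ, Nat.add_sub_cancel]) (by
        intro Y hY
        by_cases hYX : Y = X
        · rwa [hYX]
        · exact (hH Y fun h => hY (Finset.mem_erase.2 ⟨hYX, h⟩)).mono hG₁H)
    refine ⟨G₂, hG₂.trans hG₁H, ?_, J', hJ'.trans (Finset.erase_subset _ _), h1, h2⟩
    calc H.card ≤ (m + 2) * (G X).card := hGX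
      _ ≤ (m + 2) * (K * (M * G₂.card)) := by gcongr; exact hG₁K.trans (by gcongr)
      _ = (m + 2) * (K * M) * G₂.card := by ring
      _ ≤ _ := by gcongr; exact Nat.le_add_right _ _

end Homogeneous

/-! ### Rainbow subfamilies by averaging over colourings. -/

section Rainbow

variable {α : Type*} [Fintype α] [DecidableEq α]

/-- A proportion of any uniform family is rainbow for some colouring. -/
theorem exists_rainbow_subset {r : ℕ} (hr : 0 < r) (H : Finset (Finset α))
    (hH : ∀ e ∈ H, e.card = r) :
    ∃ χ : α → Fin r, ∃ G ⊆ H, H.card ≤ r ^ r * G.card ∧ ∀ e ∈ G, Set.InjOn χ e := by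
  classical
  have : Nonempty (Fin r) := ⟨⟨0, hr⟩⟩
  -- Fixing one bijection from `e` to the colours and colouring the other vertices freely already
  -- gives a proportion `r ^ (-r)` of all colourings.
  have hcol : ∀ e ∈ H, Fintype.card (α → Fin r) ≤
      r ^ r * (Finset.univ.filter (fun χ : α → Fin r => Set.InjOn χ e)).card := by
    intro e he
    let g : e ≃ Fin r := Finset.equivFinOfCardEq (hH e he)
    have hsub : Fintype.piFinset (fun v => if hv : v ∈ e then {g ⟨v, hv⟩} else Finset.univ) ⊆
        Finset.univ.filter (fun χ : α → Fin r => Set.InjOn χ e) := by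
      intro χ hχ
      rw [Fintype.mem_piFinset] at hχ
      have hχ' : ∀ v (hv : v ∈ e), χ v = g ⟨v, hv⟩ := fun v hv => by simpa [hv] using hχ v
      refine Finset.mem_filter.2 ⟨Finset.mem_univ _, fun v hv w hw hvw => ?_⟩
      rw [Finset.mem_coe] at hv hw
      rw [hχ' v hv, hχ' w hw] at hvw
      exact congrArg Subtype.val (g.injective hvw)
    have hcard : (Fintype.piFinset (fun v => if hv : v ∈ e then {g ⟨v, hv⟩} else
        (Finset.univ : Finset (Fin r)))).card = r ^ (Fintype.card α - r) := by
      rw [Fintype.card_piFinset]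
      have : ∀ v, (if hv : v ∈ e then {g ⟨v, hv⟩} else (Finset.univ : Finset (Fin r))).card =
          if v ∈ e then 1 else r := fun v => by split <;> simp
      simp_rw [this]
      rw [Finset.prod_ite]
      simp [Finset.filter_not, Finset.card_univ_sdiff, hH e he]
    have hle : r ≤ Fintype.card α := hH e he ▸ Finset.card_le_univ e
    calc Fintype.card (α → Fin r) = r ^ r * r ^ (Fintype.card α - r) := by
          rw [← pow_add, Nat.add_sub_cancel' hle]; simp
      _ ≤ _ := by rw [← hcard]; gcongr
  obtain ⟨χ, -, hχ⟩ : ∃ χ ∈ (Finset.univ : Finset (α → Fin r)),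
      H.card ≤ r ^ r * (H.filter (fun e : Finset α => Set.InjOn χ e)).card := by
    refine Finset.exists_le_of_sum_le Finset.univ_nonempty ?_
    have hsum : ∑ χ : α → Fin r, (H.filter (fun e : Finset α => Set.InjOn χ e)).card =
        ∑ e ∈ H, (Finset.univ.filter (fun χ : α → Fin r => Set.InjOn χ e)).card := by
      simp_rw [Finset.card_filter]
      exact Finset.sum_comm
    rw [← Finset.mul_sum, hsum, Finset.mul_sum, Finset.sum_const, smul_eq_mul, mul_comm,
      Finset.card_univ, ← smul_eq_mul]
    exact Finset.card_nsmul_le_sum _ _ _ hcol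
  exact ⟨χ, _, Finset.filter_subset _ _, hχ, fun e he => (Finset.mem_filter.1 he).2⟩

end Rainbow

/-! ### Colour parts of rainbow sets. -/

section RainbowParts

variable {α : Type*} {r : ℕ} {χ : α → Fin r} {e : Finset α}

theorem mem_colorPart {X : Finset (Fin r)} {v : α} : v ∈ colorPart χ X e ↔ v ∈ e ∧ χ v ∈ X :=
  Finset.mem_filter

theorem image_eq_univ_of_rainbow (hcard : e.card = r) (hinj : Set.InjOn χ e) :
    e.image χ = Finset.univ := by
  rw [← Finset.card_eq_iff_eq_univ, Finset.card_image_of_injOn hinj, hcard, Fintype.card_fin]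

theorem card_colorPart_of_rainbow (hcard : e.card = r) (hinj : Set.InjOn χ e)
    (X : Finset (Fin r)) : (colorPart χ X e).card = X.card := by
  have himg : (colorPart χ X e).image χ = X := by
    ext i
    simp only [Finset.mem_image, mem_colorPart]
    constructor
    · rintro ⟨v, ⟨-, hv⟩, rfl⟩
      exact hv
    · intro hi
      have hi' : i ∈ e.image χ := by
        rw [image_eq_univ_of_rainbow hcard hinj]
        exact Finset.mem_univ i
      obtain ⟨v, hv, rfl⟩ := Finset.mem_image.1 hi'
      exact ⟨v, ⟨hv, hi⟩, rfl⟩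
  conv_rhs => rw [← himg]
  refine (Finset.card_image_of_injOn (hinj.mono ?_)).symm
  exact Finset.coe_subset.2 (Finset.filter_subset _ _)

theorem colorPart_union_compl [DecidableEq α] (X : Finset (Fin r)) (e : Finset α) :
    colorPart χ X e ∪ colorPart χ Xᶜ e = e := by
  ext v
  simp only [Finset.mem_union, mem_colorPart, Finset.mem_compl]
  tauto

theorem disjoint_colorPart_compl (X : Finset (Fin r)) (e e' : Finset α) :
    Disjoint (colorPart χ X e) (colorPart χ Xᶜ e') :=
  Finset.disjoint_left.2 fun _ hv hv' =>
    Finset.mem_compl.1 (mem_colorPart.1 hv').2 (mem_colorPart.1 hv).2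

theorem colorPart_image_of_subset (hinj : Set.InjOn χ e) {A : Finset α} (hA : A ⊆ e) :
    colorPart χ (A.image χ) e = A := by
  ext v
  rw [mem_colorPart, Finset.mem_image]
  constructor
  · rintro ⟨hv, w, hw, hwv⟩
    rwa [← hinj (hA hw) hv hwv]
  · exact fun hv => ⟨hA hv, v, hv, rfl⟩

theorem colorPart_eq_of_subset {X Y : Finset (Fin r)} (hXY : X ⊆ Y) {e e' : Finset α}
    (h : colorPart χ Y e = colorPart χ Y e') : colorPart χ X e = colorPart χ X e' := by
  have key : ∀ e : Finset α, colorPart χ X e = (colorPart χ Y e).filter (χ · ∈ X) := by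
    intro e
    ext v
    simp only [mem_colorPart, Finset.mem_filter]
    exact ⟨fun hv => ⟨⟨hv.1, hXY hv.2⟩, hv.2⟩, fun hv => ⟨hv.1.1, hv.2⟩⟩
  rw [key e, key e', h]

end RainbowParts

/-! ### Kernel types in rainbow families, and centers. -/

section HomogeneousRainbow

variable {α : Type*} {r K : ℕ} {χ : α → Fin r} {G : Finset (Finset α)}
  {J : Finset (Finset (Fin r))}

theorem univ_mem_of_homogeneous (hG : G.Nonempty) (havoid : ∀ X ∉ J, IsAvoidedType χ G X) :
    Finset.univ ∈ J := by
  by_contra h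
  obtain ⟨e, he⟩ := hG
  obtain ⟨v, -, -, hv⟩ := havoid _ h e he e he rfl
  exact hv (Finset.mem_univ _)

/-- Choose `e₁` sharing the `X`-part of `e` and otherwise avoiding `e`, then `e₂` sharing the
`Y`-part of `e` and otherwise avoiding `e₁`. They meet only in colours of `X ∩ Y`, where they agree,
so `X ∩ Y` is not avoided. -/
theorem inter_mem_of_homogeneous (hrK : r ≤ K) (hcard : ∀ e ∈ G, e.card = r) (hG : G.Nonempty)
    (hker : ∀ X ∈ J, IsKernelType χ K G X) (havoid : ∀ X ∉ J, IsAvoidedType χ G X)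
    {X Y : Finset (Fin r)} (hX : X ∈ J) (hY : Y ∈ J) : X ∩ Y ∈ J := by
  by_contra hXY
  obtain ⟨e, he⟩ := hG
  obtain ⟨e₁, he₁, hX₁, hd₁⟩ := hker X hX e he e ((hcard e he).trans_le hrK)
  obtain ⟨e₂, he₂, hY₂, hd₂⟩ := hker Y hY e he e₁ ((hcard e₁ he₁).trans_le hrK)
  obtain ⟨v, hv₁, hv₂, hv⟩ := havoid _ hXY e₁ he₁ e₂ he₂
    ((colorPart_eq_of_subset Finset.inter_subset_left hX₁).trans
      (colorPart_eq_of_subset Finset.inter_subset_right hY₂).symm)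
  have hvY : χ v ∈ Y := by_contra fun h => hd₂ v hv₂ h hv₁
  have hve : v ∈ e := by
    have : v ∈ colorPart χ Y e₂ := mem_colorPart.2 ⟨hv₂, hvY⟩
    rw [hY₂] at this
    exact (mem_colorPart.1 this).1
  have hvX : χ v ∈ X := by_contra fun h => hd₁ v hv₁ h hve
  exact hv (Finset.mem_inter.2 ⟨hvX, hvY⟩)

variable [DecidableEq α]

/-- Members are determined by their `X`-parts: if two agree there, the colour set of their
intersection contains `X` and is not avoided, hence is everything. -/
theorem card_le_of_uncovered_type [Fintype α] (hcard : ∀ e ∈ G, e.card = r)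
    (hinj : ∀ e ∈ G, Set.InjOn χ e) (havoid : ∀ X ∉ J, IsAvoidedType χ G X)
    {X : Finset (Fin r)} (hX : ∀ Y ∈ J, X ⊆ Y → Y = Finset.univ) :
    G.card ≤ (Fintype.card α).choose X.card := by
  rw [← Finset.card_univ (α := α), ← Finset.card_powersetCard]
  refine Finset.card_le_card_of_injOn (colorPart χ X) ?_ ?_
  · intro e he
    rw [Finset.mem_coe, Finset.mem_powersetCard]
    exact ⟨Finset.subset_univ _, card_colorPart_of_rainbow (hcard e he) (hinj e he) X⟩
  · intro e he e' he' hee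
    rw [Finset.mem_coe] at he he'
    set Y := (e ∩ e').image χ with hY
    have hYe : colorPart χ Y e = e ∩ e' :=
      colorPart_image_of_subset (hinj e he) Finset.inter_subset_left
    have hYe' : colorPart χ Y e' = e ∩ e' :=
      colorPart_image_of_subset (hinj e' he') Finset.inter_subset_right
    have hXY : X ⊆ Y := by
      intro i hi
      have hi' : i ∈ e.image χ := by
        rw [image_eq_univ_of_rainbow (hcard e he) (hinj e he)]
        exact Finset.mem_univ i
      obtain ⟨v, hv, rfl⟩ := Finset.mem_image.1 hi'
      have hvX : v ∈ colorPart χ X e := mem_colorPart.2 ⟨hv, hi⟩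
      have hvX' := hvX
      rw [hee] at hvX'
      exact Finset.mem_image_of_mem _
        (Finset.mem_inter.2 ⟨(mem_colorPart.1 hvX).1, (mem_colorPart.1 hvX').1⟩)
    have hYJ : Y ∈ J := by
      by_contra hYJ
      obtain ⟨v, hv, hv', hvY⟩ := havoid Y hYJ e he e' he' (hYe.trans hYe'.symm)
      exact hvY (Finset.mem_image_of_mem _ (Finset.mem_inter.2 ⟨hv, hv'⟩))
    have hsub : e ⊆ e' := by
      rw [← Finset.inter_eq_left, ← hYe, hX Y hYJ hXY]
      simp [colorPart]
    exact Finset.eq_of_subset_of_card_le hsub (by rw [hcard e he, hcard e' he'])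

theorem isExtendable_colorPart_compl {a : ℕ} (hcard : ∀ e ∈ G, e.card = r)
    (hinj : ∀ e ∈ G, Set.InjOn χ e) {X : Finset (Fin r)} (hXa : X.card = a)
    (hker : IsKernelType χ K G Xᶜ) {e : Finset α} (he : e ∈ G) :
    IsExtendable G a K (colorPart χ Xᶜ e) := by
  intro W hW
  obtain ⟨e', he', hee, hd⟩ := hker e he W hW
  refine ⟨colorPart χ X e', ?_, ?_, ?_⟩
  · rw [card_colorPart_of_rainbow (hcard e' he') (hinj e' he'), hXa]
  · rwa [← hee, colorPart_union_compl]
  · refine Finset.disjoint_left.2 fun v hv => ?_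
    rw [mem_colorPart] at hv
    exact hd v hv.1 fun h => Finset.mem_compl.1 h hv.2

/-- The kernel type `Y` supplies the link and `Xᶜ` makes the new `b`-set extendable. It is applied
with `Y = X` (empty core) and with `Y` equal to `X` plus the colour of a center. -/
theorem isLinked_of_kernelType {a b : ℕ} (hab : r = a + b) (hcard : ∀ e ∈ G, e.card = r)
    (hinj : ∀ e ∈ G, Set.InjOn χ e) {X Y : Finset (Fin r)} (hXa : X.card = a) (hXY : X ⊆ Y)
    (hY : IsKernelType χ K G Y) (hXc : IsKernelType χ K G Xᶜ) {e : Finset α} (he : e ∈ G) :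
    IsLinked G a b K (colorPart χ X e) (colorPart χ (Y \ X) e) := by
  intro W hW
  obtain ⟨e', he', hee, hd⟩ := hY e he W hW
  refine ⟨colorPart χ Xᶜ e', ?_, ?_, ?_, disjoint_colorPart_compl _ _ _, ?_,
    isExtendable_colorPart_compl hcard hinj hXa hXc he'⟩
  · rw [← colorPart_eq_of_subset Finset.sdiff_subset hee]
    intro v hv
    rw [mem_colorPart, Finset.mem_sdiff] at hv
    exact mem_colorPart.2 ⟨hv.1, Finset.mem_compl.2 hv.2.2⟩
  · rw [card_colorPart_of_rainbow (hcard e' he') (hinj e' he'), Finset.card_compl,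
      Fintype.card_fin, hXa]
    omega
  · rwa [← colorPart_eq_of_subset hXY hee, colorPart_union_compl]
  · refine Finset.disjoint_left.2 fun v hv => ?_
    rw [← colorPart_eq_of_subset Finset.sdiff_subset hee, Finset.mem_sdiff, mem_colorPart,
      mem_colorPart, Finset.mem_sdiff, Finset.mem_compl] at hv
    exact hd v hv.1.1 fun h => hv.2 ⟨hv.1.1, h, hv.1.2⟩

/-- `c` is a center of `e`: every `a`-subset of `e` avoiding `c` is linked to `c`. -/
def IsCenter (H : Finset (Finset α)) (a b K : ℕ) (e : Finset α) (c : α) : Prop :=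
  c ∈ e ∧ ∀ A ⊆ e, c ∉ A → A.card = a → IsLinked H a b K A {c}

theorem exists_isCenter_of_homogeneous [Fintype α] {a b s h : ℕ} (ha : 2 ≤ a) (hb : 2 ≤ b)
    (hab : r = a + b) (hr : 5 ≤ r) (hK : a + s * b + s + s * h * a + r ≤ K)
    (hcard : ∀ e ∈ G, e.card = r) (hinj : ∀ e ∈ G, Set.InjOn χ e)
    (hker : ∀ X ∈ J, IsKernelType χ K G X) (havoid : ∀ X ∉ J, IsAvoidedType χ G X)
    (hbush : ¬ ContainsBush G a b s h) (hlarge : (Fintype.card α).choose (r - 2) < G.card) :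
    ∃ e ∈ G, ∃ c, IsCenter G a b K e c := by
  classical
  have hG : G.Nonempty := Finset.card_pos.1 (by omega)
  obtain ⟨e, he⟩ := hG
  have hG : G.Nonempty := ⟨e, he⟩
  have hstruct := complementary_or_principal ha hb hab hr (J := {X | X ∈ J})
    (univ_mem_of_homogeneous hG havoid)
    (fun X hX Y hY => inter_mem_of_homogeneous (by omega) hcard hG hker havoid hX hY)
    (by
      intro X hX
      by_contra! hcon
      refine hlarge.not_ge ?_
      rw [← hX]
      exact card_le_of_uncovered_type hcard hinj havoid
        (fun Y hY hXY => by_contra fun hYu => hcon Y hY hYu hXY))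
  rcases hstruct with ⟨X, hX, hXc, hXa⟩ | ⟨i, hi⟩
  -- For a complementary pair, the `X`-part of `e` is linked to the empty core, which can be used
  -- for all `s` branches.
  · refine absurd (containsBush_of_isLinked (K := K) (by omega)
      (A := colorPart χ X e) (C := fun _ => ∅) ?_ (by simp) (by simp) fun _ => ?_) hbush
    · rw [card_colorPart_of_rainbow (hcard e he) (hinj e he), hXa]
    · have := isLinked_of_kernelType hab hcard hinj hXa subset_rfl (hker X hX) (hker _ hXc) he
      simpa [colorPart] using this
  · have hmem : i ∈ e.image χ := by
      rw [image_eq_univ_of_rainbow (hcard e he) (hinj e he)]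
      exact Finset.mem_univ i
    obtain ⟨c, hc, rfl⟩ := Finset.mem_image.1 hmem
    refine ⟨e, he, c, hc, fun A hA hcA hAa => ?_⟩
    have hcX : χ c ∉ A.image χ := by
      intro h
      obtain ⟨w, hw, hwc⟩ := Finset.mem_image.1 h
      exact hcA (hinj e he (hA hw) hc hwc ▸ hw)
    have hlink := isLinked_of_kernelType hab hcard hinj (X := A.image χ)
      (Y := insert (χ c) (A.image χ))
      (by rw [Finset.card_image_of_injOn ((hinj e he).mono (Finset.coe_subset.2 hA)), hAa])
      (Finset.subset_insert _ _) (hker _ (hi _ (Finset.mem_insert_self _ _)))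
      (hker _ (hi _ (Finset.mem_compl.2 hcX))) he
    have hdiff : insert (χ c) (A.image χ) \ A.image χ = ({c} : Finset α).image χ := by
      rw [Finset.insert_sdiff_of_notMem _ hcX, Finset.sdiff_self, Finset.image_singleton]
      rfl
    rwa [hdiff, colorPart_image_of_subset (hinj e he) hA,
      colorPart_image_of_subset (hinj e he) (Finset.singleton_subset_iff.2 hc)] at hlink

theorem IsCenter.mono {H : Finset (Finset α)} (hGH : G ⊆ H) {a b : ℕ} {e : Finset α} {c : α}
    (h : IsCenter G a b K e c) : IsCenter H a b K e c :=
  ⟨h.1, fun A hA hcA hAa => (h.2 A hA hcA hAa).mono hGH⟩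

theorem ContainsBush.mono {H : Finset (Finset α)} (hGH : G ⊆ H) {a b s h : ℕ}
    (hG : ContainsBush G a b s h) : ContainsBush H a b s h :=
  let ⟨F, hF, hFb⟩ := hG
  ⟨F, hF.trans (Finset.coe_subset.2 hGH), hFb⟩

end HomogeneousRainbow

/-- In a bush-free family all but few members have a center. -/
theorem exists_bound_of_forall_not_isCenter {a b s h r K : ℕ} (ha : 2 ≤ a) (hb : 2 ≤ b)
    (hab : r = a + b) (hr : 5 ≤ r) (hK : a + s * b + s + s * h * a + r ≤ K) :
    ∃ M : ℕ, ∀ n : ℕ, ∀ H : Finset (Finset (Fin n)), (∀ e ∈ H, e.card = r) →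
      ¬ ContainsBush H a b s h → ∀ G ⊆ H, (∀ e ∈ G, ∀ c, ¬ IsCenter H a b K e c) →
      G.card ≤ M * n.choose (r - 2) := by
  obtain ⟨M, hM⟩ := exists_homogeneous_subset (Fin r) K (Fintype.card (Finset (Fin r)))
  refine ⟨r ^ r * M, fun n H hH hbush G hGH hG => ?_⟩
  obtain ⟨χ, G₁, hG₁, hG₁c, hinj⟩ := exists_rainbow_subset (by omega) G fun e he => hH e (hGH he)
  obtain ⟨G₂, hG₂, hG₂c, J, -, hker, havoid⟩ := hM (Fin n) χ Finset.univ G₁ (Finset.card_univ)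
    (fun X hX => absurd (Finset.mem_univ X) hX)
  have hG₂H : G₂ ⊆ H := hG₂.trans (hG₁.trans hGH)
  have hle : G₂.card ≤ n.choose (r - 2) := by
    by_contra! hlt
    obtain ⟨e, he, c, hc⟩ := exists_isCenter_of_homogeneous ha hb hab hr hK
      (fun e he => hH e (hG₂H he)) (fun e he => hinj e (hG₂ he)) hker havoid
      (fun h => hbush (h.mono hG₂H)) (by rwa [Fintype.card_fin])
    exact hG e (hG₁ (hG₂ he)) c (hc.mono hG₂H)
  calc G.card ≤ r ^ r * G₁.card := hG₁c
    _ ≤ r ^ r * (M * n.choose (r - 2)) := by gcongr; exact hG₂c.trans (by gcongr)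
    _ = _ := by ring

/-! ### Almost constant functions on `k`-sets. -/

section Popular

theorem card_filter_apply_eq_le {k n : ℕ} {i j : Fin k} (hij : i ≠ j) :
    (Finset.univ.filter (fun f : Fin k → Fin n => f i = f j)).card ≤ n ^ (k - 1) := by
  have hcard : (Finset.univ : Finset ({x : Fin k // x ≠ i} → Fin n)).card = n ^ (k - 1) := by
    simp [Fintype.card_subtype_compl]
  rw [← hcard]
  refine Finset.card_le_card_of_injOn (fun f x => f x) (fun _ _ => Finset.mem_univ _) ?_
  intro f hf g hg hfg
  rw [Finset.mem_coe, Finset.mem_filter] at hf hg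
  have h : ∀ x, x ≠ i → f x = g x := fun x hx => congrFun hfg ⟨x, hx⟩
  funext x
  by_cases hx : x = i
  · rw [hx, hf.2, hg.2, h j hij.symm]
  · exact h x hx

theorem card_filter_not_injective_le (k n : ℕ) :
    (Finset.univ.filter (fun f : Fin k → Fin n => ¬ Function.Injective f)).card ≤
      k * k * n ^ (k - 1) := by
  have hsub : Finset.univ.filter (fun f : Fin k → Fin n => ¬ Function.Injective f) ⊆
      (Finset.univ.filter (fun p : Fin k × Fin k => p.1 ≠ p.2)).biUnion
        (fun p => Finset.univ.filter (fun f : Fin k → Fin n => f p.1 = f p.2)) := by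
    intro f hf
    rw [Finset.mem_filter, Function.Injective] at hf
    push Not at hf
    obtain ⟨-, i, j, hfij, hij⟩ := hf
    exact Finset.mem_biUnion.2 ⟨(i, j), by simpa using hij, by simpa using hfij⟩
  refine (Finset.card_le_card hsub).trans ((Finset.card_biUnion_le_card_mul _ _ (n ^ (k - 1))
    fun p hp => card_filter_apply_eq_le (Finset.mem_filter.1 hp).2).trans ?_)
  gcongr
  exact (Finset.card_le_univ _).trans (by simp)

theorem card_filter_image_mem_le {k n : ℕ} (F : Finset (Finset (Fin n)))
    (hF : ∀ Y ∈ F, Y.card = k) :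
    (Finset.univ.filter (fun f : Fin k → Fin n => Finset.univ.image f ∈ F)).card ≤
      F.card * k ^ k := by
  have hsub : Finset.univ.filter (fun f : Fin k → Fin n => Finset.univ.image f ∈ F) ⊆
      F.biUnion (fun Y => Fintype.piFinset fun _ : Fin k => Y) := by
    intro f hf
    refine Finset.mem_biUnion.2 ⟨_, (Finset.mem_filter.1 hf).2, ?_⟩
    rw [Fintype.mem_piFinset]
    exact fun i => Finset.mem_image_of_mem _ (Finset.mem_univ _)
  refine (Finset.card_le_card hsub).trans (Finset.card_biUnion_le_card_mul _ _ _ fun Y hY => ?_)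
  simp [hF Y hY]

/-- The tuple that agrees with `p.2` before position `i` and with `p.1` from there on. -/
def hybrid {k : ℕ} {β : Type*} (i : ℕ) (p : (Fin k → β) × (Fin k → β)) : Fin k → β :=
  fun j => if j.val < i then p.2 j else p.1 j

/-- A pair of tuples is recovered from its two complementary hybrids, so each hybrid of a uniform
random pair is itself uniform. -/
theorem card_filter_hybrid_mem_le {k n : ℕ} (i : ℕ) (B : Finset (Fin k → Fin n)) :
    (Finset.univ.filter (fun p : (Fin k → Fin n) × (Fin k → Fin n) => hybrid i p ∈ B)).card ≤
      B.card * n ^ k := by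
  have hcard : (B ×ˢ (Finset.univ : Finset (Fin k → Fin n))).card = B.card * n ^ k := by
    simp [Finset.card_product]
  rw [← hcard]
  refine Finset.card_le_card_of_injOn (fun p => (hybrid i p, hybrid i p.swap)) ?_ ?_
  · intro p hp
    rw [Finset.mem_coe, Finset.mem_filter] at hp
    exact Finset.mem_coe.2 (Finset.mem_product.2 ⟨hp.2, Finset.mem_univ _⟩)
  · rintro ⟨f, g⟩ - ⟨f', g'⟩ - h
    rw [Prod.mk.injEq] at h
    have h1 : ∀ j, hybrid i (f, g) j = hybrid i (f', g') j := fun j => congrFun h.1 j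
    have h2 : ∀ j, hybrid i (g, f) j = hybrid i (g', f') j := fun j => congrFun h.2 j
    simp only [hybrid] at h1 h2
    rw [Prod.mk.injEq]
    constructor <;> funext j <;> have h1 := h1 j <;> have h2 := h2 j <;>
      split_ifs at h1 h2 <;> assumption

/-- A value attached to almost all `k`-sets, and shared by neighbouring ones, is almost
constant. -/
theorem exists_popular_value {k n E : ℕ} (hk : 1 ≤ k) {β : Type*} (N : Finset (Fin n) → β)
    (F : Finset (Finset (Fin n))) (hFk : ∀ Y ∈ F, Y.card = k) (hF : F.card ≤ E * n ^ (k - 1))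
    (hN : ∀ Y Y' : Finset (Fin n), Y.card = k → Y'.card = k → Y ∉ F → Y' ∉ F →
      k - 1 ≤ (Y ∩ Y').card → N Y = N Y')
    (hn : (k + 1) * (k * k + E * k ^ k) < n) :
    ∃ Y₀ : Finset (Fin n), Y₀.card = k ∧ Y₀ ∉ F ∧ ∃ R : Finset (Finset (Fin n)),
      R.card ≤ (k + 1) * (k * k + E * k ^ k) * n ^ (k - 1) ∧
      ∀ Y : Finset (Fin n), Y.card = k → Y ∉ R → Y ∉ F ∧ N Y = N Y₀ := by
  classical
  set D := k * k + E * k ^ k with hD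
  have hn0 : 0 < n := by omega
  have : Nonempty (Fin n) := ⟨⟨0, hn0⟩⟩
  set B : Finset (Fin k → Fin n) := Finset.univ.filter (fun f => ¬ Function.Injective f) ∪
    Finset.univ.filter (fun f => Finset.univ.image f ∈ F) with hBdef
  have hB : B.card ≤ D * n ^ (k - 1) := by
    refine (Finset.card_union_le _ _).trans ((Nat.add_le_add (card_filter_not_injective_le k n)
      ((card_filter_image_mem_le F hFk).trans (Nat.mul_le_mul_right _ hF))).trans ?_)
    rw [hD]
    apply le_of_eq
    ring
  have hgood : ∀ f, f ∉ B → Function.Injective f ∧ Finset.univ.image f ∉ F := fun f hf => by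
    simpa [hBdef] using hf
  have hcardimg : ∀ f : Fin k → Fin n, Function.Injective f →
      (Finset.univ.image f).card = k := fun f hf => by
    rw [Finset.card_image_of_injective _ hf, Finset.card_univ, Fintype.card_fin]
  -- The hybrids for `i = 0, ..., k` lead from `f` to `g`, changing one coordinate at a time.
  -- Averaging yields an `f` whose paths to almost all `g` avoid `B`.
  let bad : (Fin k → Fin n) → (Fin k → Fin n) → Prop := fun f g =>
    ∃ i ∈ Finset.range (k + 1), hybrid i (f, g) ∈ B
  obtain ⟨f, -, hf⟩ : ∃ f ∈ (Finset.univ : Finset (Fin k → Fin n)),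
      (Finset.univ.filter (bad f)).card ≤ (k + 1) * D * n ^ (k - 1) := by
    refine Finset.exists_le_of_sum_le Finset.univ_nonempty ?_
    have h1 : ∑ f : Fin k → Fin n, (Finset.univ.filter (bad f)).card =
        (Finset.univ.filter (fun p : (Fin k → Fin n) × (Fin k → Fin n) => bad p.1 p.2)).card := by
      simp_rw [Finset.card_filter]
      rw [← Finset.univ_product_univ, Finset.sum_product]
    have h2 : Finset.univ.filter (fun p : (Fin k → Fin n) × (Fin k → Fin n) => bad p.1 p.2) ⊆
        (Finset.range (k + 1)).biUnion
          (fun i => Finset.univ.filter (fun p => hybrid i p ∈ B)) := by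
      intro p hp
      obtain ⟨i, hi, hip⟩ := (Finset.mem_filter.1 hp).2
      exact Finset.mem_biUnion.2 ⟨i, hi, Finset.mem_filter.2 ⟨Finset.mem_univ _, hip⟩⟩
    rw [h1]
    refine (Finset.card_le_card h2).trans ((Finset.card_biUnion_le_card_mul _ _ _
      fun i _ => card_filter_hybrid_mem_le i B).trans ?_)
    rw [Finset.card_range, Finset.sum_const, smul_eq_mul, Finset.card_univ, Fintype.card_fun,
      Fintype.card_fin, Fintype.card_fin]
    calc (k + 1) * (B.card * n ^ k) ≤ (k + 1) * (D * n ^ (k - 1) * n ^ k) := by gcongr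
      _ = _ := by ring
  have hlast : ∀ g, hybrid k (f, g) = g := fun g => by
    funext j
    simp [hybrid, j.isLt]
  have hzero : ∀ g, hybrid 0 (f, g) = f := fun g => by
    funext j
    simp [hybrid]
  have hstep : ∀ g, ¬ bad f g → ∀ i ≤ k,
      N (Finset.univ.image (hybrid i (f, g))) = N (Finset.univ.image f) := by
    intro g hg i
    have hgood' : ∀ i ≤ k, hybrid i (f, g) ∉ B := fun i hi hmem =>
      hg ⟨i, Finset.mem_range.2 (by omega), hmem⟩
    induction i with
    | zero => simp [hzero]
    | succ i ih =>
      intro hi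
      rw [← ih (by omega)]
      obtain ⟨hinj, hnF⟩ := hgood _ (hgood' i (by omega))
      obtain ⟨hinj', hnF'⟩ := hgood _ (hgood' (i + 1) hi)
      refine hN _ _ (hcardimg _ hinj') (hcardimg _ hinj) hnF' hnF ?_
      have hsub : (Finset.univ.erase (⟨i, hi⟩ : Fin k)).image (hybrid i (f, g)) ⊆
          Finset.univ.image (hybrid (i + 1) (f, g)) ∩ Finset.univ.image (hybrid i (f, g)) := by
        intro x hx
        obtain ⟨j, hj, rfl⟩ := Finset.mem_image.1 hx
        have hji : j.val ≠ i := fun h => (Finset.mem_erase.1 hj).1 (Fin.ext h)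
        refine Finset.mem_inter.2 ⟨Finset.mem_image.2 ⟨j, Finset.mem_univ _, ?_⟩,
          Finset.mem_image_of_mem _ (Finset.mem_univ _)⟩
        simp only [hybrid]
        split_ifs <;> first | rfl | omega
      refine le_of_eq_of_le ?_ (Finset.card_le_card hsub)
      rw [Finset.card_image_of_injective _ hinj, Finset.card_erase_of_mem (Finset.mem_univ _),
        Finset.card_univ, Fintype.card_fin]
  -- Otherwise every `g` is bad, already at `i = 0`, which is too many because `n` exceeds the
  -- constant in `hn`.
  have hfB : f ∉ B := by
    intro hfB
    have hall : Finset.univ.filter (bad f) = Finset.univ :=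
      Finset.filter_true_of_mem fun g _ => ⟨0, by simp, by rwa [hzero]⟩
    rw [hall, Finset.card_univ, Fintype.card_fun, Fintype.card_fin, Fintype.card_fin] at hf
    have hpow : n ^ k = n * n ^ (k - 1) := by
      rw [← pow_succ', Nat.sub_add_cancel hk]
    rw [hpow] at hf
    exact absurd (Nat.le_of_mul_le_mul_right hf (pow_pos hn0 _)) (by omega)
  refine ⟨Finset.univ.image f, hcardimg f (hgood f hfB).1, (hgood f hfB).2,
    (Finset.univ.filter (bad f)).image (fun g => Finset.univ.image g),
    Finset.card_image_le.trans hf, fun Y hY hYR => ?_⟩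
  let g : Fin k → Fin n := ⇑(Y.orderEmbOfFin hY)
  have himg : Finset.univ.image g = Y := Finset.image_orderEmbOfFin_univ Y hY
  have hgood_g : ¬ bad f g := fun h =>
    hYR (Finset.mem_image.2 ⟨g, Finset.mem_filter.2 ⟨Finset.mem_univ _, h⟩, himg⟩)
  have hgB : g ∉ B := fun h => hgood_g ⟨k, by simp, by rwa [hlast]⟩
  have hval := hstep g hgood_g k le_rfl
  rw [hlast, himg] at hval
  exact ⟨himg ▸ (hgood g hgB).2, hval⟩

end Popular

/-! ### Extension centers and stability. -/

section Stability

variable {α : Type*} [DecidableEq α] {H : Finset (Finset α)} {a b s h K : ℕ}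

theorem card_lt_of_isLinked (hK : a + s * b + s + s * h * a ≤ K)
    (hbush : ¬ ContainsBush H a b s h) {A : Finset α} (hA : A.card = a) {T : Finset α}
    (hT : ∀ c ∈ T, IsLinked H a b K A {c}) : T.card < s := by
  by_contra! hs
  obtain ⟨f⟩ : Nonempty (Fin s ↪ T) := Function.Embedding.nonempty_of_card_le (by simpa using hs)
  refine hbush (containsBush_of_isLinked hK hA (C := fun i => {(f i : α)}) (by simp) ?_
    fun i => hT _ (f i).2)
  intro i j hij
  rw [Finset.disjoint_singleton]
  exact fun h => hij (f.injective (Subtype.ext h))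

variable [Fintype α]

open Classical in
/-- The vertices that extend `Y` to a member of `H` and are a center of it. -/
noncomputable def extensionCenters (H : Finset (Finset α)) (a b K : ℕ) (Y : Finset α) :
    Finset α :=
  Finset.univ.filter (fun c => c ∉ Y ∧ insert c Y ∈ H ∧ IsCenter H a b K (insert c Y) c)

theorem mem_extensionCenters {Y : Finset α} {c : α} : c ∈ extensionCenters H a b K Y ↔
    c ∉ Y ∧ insert c Y ∈ H ∧ IsCenter H a b K (insert c Y) c := by
  simp [extensionCenters]

theorem isLinked_of_mem_extensionCenters {A Y : Finset α} (hAY : A ⊆ Y) (hA : A.card = a) {c : α}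
    (hc : c ∈ extensionCenters H a b K Y) : IsLinked H a b K A {c} := by
  rw [mem_extensionCenters] at hc
  exact hc.2.2.2 A (hAY.trans (Finset.subset_insert _ _)) (fun h => hc.1 (hAY h)) hA

theorem card_extensionCenters_lt (hK : a + s * b + s + s * h * a ≤ K)
    (hbush : ¬ ContainsBush H a b s h) {Y : Finset α} (hY : a ≤ Y.card) :
    (extensionCenters H a b K Y).card < s := by
  obtain ⟨A, hAY, hA⟩ := Finset.exists_subset_card_eq hY
  exact card_lt_of_isLinked hK hbush hA fun c hc => isLinked_of_mem_extensionCenters hAY hA hc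

/-- A common `a`-subset is linked to every vertex of both center sets, so their union has fewer than
`s` elements, while each already has `s - 1`. -/
theorem extensionCenters_eq_of_le_card_inter (hK : a + s * b + s + s * h * a ≤ K)
    (hbush : ¬ ContainsBush H a b s h) {Y Y' : Finset α} (hY : a ≤ (Y ∩ Y').card)
    (h1 : (extensionCenters H a b K Y).card = s - 1)
    (h2 : (extensionCenters H a b K Y').card = s - 1) :
    extensionCenters H a b K Y = extensionCenters H a b K Y' := by
  obtain ⟨A, hAY, hA⟩ := Finset.exists_subset_card_eq hY
  rw [Finset.subset_inter_iff] at hAY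
  have hlt := card_lt_of_isLinked (T := extensionCenters H a b K Y ∪ extensionCenters H a b K Y')
    hK hbush hA (fun c hc => by
      rcases Finset.mem_union.1 hc with hc | hc
      · exact isLinked_of_mem_extensionCenters hAY.1 hA hc
      · exact isLinked_of_mem_extensionCenters hAY.2 hA hc)
  have e1 := Finset.eq_of_subset_of_card_le (Finset.subset_union_left (s₁ :=
    extensionCenters H a b K Y) (s₂ := extensionCenters H a b K Y')) (by omega)
  have e2 := Finset.eq_of_subset_of_card_le (Finset.subset_union_right (s₁ :=
    extensionCenters H a b K Y) (s₂ := extensionCenters H a b K Y')) (by omega)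
  exact e1.trans e2.symm

/-- Deleting a center from a member gives a pair `(Y, c)` from which the member is recovered. -/
theorem card_le_sum_card_extensionCenters {r : ℕ} {G : Finset (Finset α)} (hGH : G ⊆ H)
    (hcard : ∀ e ∈ G, e.card = r) (hG : ∀ e ∈ G, ∃ c, IsCenter H a b K e c) :
    G.card ≤ ∑ Y ∈ Finset.univ.powersetCard (r - 1), (extensionCenters H a b K Y).card := by
  rw [← Finset.card_sigma]
  refine (Finset.card_le_card ?_).trans
    (Finset.card_image_le (f := fun p : (_ : Finset α) × α => insert p.2 p.1))
  intro e he
  obtain ⟨c, hc⟩ := hG e he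
  refine Finset.mem_image.2 ⟨⟨e.erase c, c⟩, Finset.mem_sigma.2 ⟨?_, ?_⟩,
    Finset.insert_erase hc.1⟩
  · rw [Finset.mem_powersetCard]
    exact ⟨Finset.subset_univ _, by rw [Finset.card_erase_of_mem hc.1, hcard e he]⟩
  · rw [mem_extensionCenters]
    simp only [Finset.insert_erase hc.1]
    exact ⟨Finset.notMem_erase _ _, hGH he, hc⟩

theorem card_deficient_add_le {k : ℕ} (hK : a + s * b + s + s * h * a ≤ K)
    (hbush : ¬ ContainsBush H a b s h) (hak : a ≤ k) :
    ((Finset.univ.powersetCard k).filter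
      (fun Y => (extensionCenters H a b K Y).card ≠ s - 1)).card +
      ∑ Y ∈ Finset.univ.powersetCard k, (extensionCenters H a b K Y).card ≤
      (s - 1) * (Fintype.card α).choose k := by
  rw [Finset.card_filter, ← Finset.sum_add_distrib, mul_comm, ← Finset.card_univ,
    ← Finset.card_powersetCard, ← smul_eq_mul]
  refine Finset.sum_le_card_nsmul _ _ _ fun Y hY => ?_
  have := card_extensionCenters_lt hK hbush (hak.trans_eq (Finset.mem_powersetCard.1 hY).2.symm)
  split_ifs <;> omega

theorem choose_le_vertexDegree_add {k : ℕ} {v : α} {R : Finset (Finset α)}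
    (hR : ∀ Y : Finset α, Y.card = k → Y ∉ R → v ∉ Y ∧ insert v Y ∈ H) :
    (Fintype.card α).choose k ≤ vertexDegree H v + R.card := by
  have h1 := Finset.card_le_card_sdiff_add_card (t := R) (s := Finset.univ.powersetCard k)
  rw [Finset.card_powersetCard, Finset.card_univ] at h1
  have hmem : ∀ Y ∈ Finset.univ.powersetCard k \ R, v ∉ Y ∧ insert v Y ∈ H := fun Y hY => by
    rw [Finset.mem_sdiff, Finset.mem_powersetCard] at hY
    exact hR Y hY.1.2 hY.2
  have h2 : (Finset.univ.powersetCard k \ R).card ≤ vertexDegree H v := by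
    refine Finset.card_le_card_of_injOn (insert v) ?_ ?_
    · intro Y hY
      exact Finset.mem_coe.2 (Finset.mem_filter.2 ⟨(hmem Y hY).2, Finset.mem_insert_self _ _⟩)
    · intro Y hY Y' hY' h
      rw [← Finset.erase_insert (hmem Y hY).1, ← Finset.erase_insert (hmem Y' hY').1]
      exact congrArg (fun e => e.erase v) h
  omega

end Stability

/-! ### The main theorem. -/

theorem theorem5 (a b s h r : ℕ) (ha : 2 ≤ a) (hb : 2 ≤ b) (hs : 1 ≤ s) (hh : 1 ≤ h)
    (hab : r = a + b) (hr : 5 ≤ r) (C₀ : ℝ) (hC₀ : 0 < C₀) :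
    ∃ n₀ : ℕ, 0 < n₀ ∧ ∃ C₁ : ℝ, 0 < C₁ ∧
      ∀ n : ℕ, n₀ < n → ∀ H : Finset (Finset (Fin n)),
        (∀ e ∈ H, e.card = r) →
        ¬ ContainsBush H a b s h →
        ((s : ℝ) - 1) * (n.choose (r - 1) : ℝ) - C₀ * (n : ℝ) ^ (r - 2) < (H.card : ℝ) →
        ∃ S : Finset (Fin n), S.card = s - 1 ∧
          ∀ v ∈ S,
            (n.choose (r - 1) : ℝ) - C₁ * (n : ℝ) ^ (r - 2) ≤ (vertexDegree H v : ℝ) := by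
  classical
  -- The first terms are the budget for building a bush; the extra `r` allows a whole member to be
  -- the forbidden set.
  obtain ⟨K, hK⟩ : ∃ K, K = a + s * b + s + s * h * a + r := ⟨_, rfl⟩
  obtain ⟨M, hM⟩ := exists_bound_of_forall_not_isCenter (K := K) ha hb hab hr hK.ge
  have hK' : a + s * b + s + s * h * a ≤ K := by omega
  obtain ⟨k, rfl⟩ : ∃ k, r = k + 1 := ⟨r - 1, by omega⟩
  have hk2 : k + 1 - 2 = k - 1 := by omega
  rw [Nat.add_sub_cancel, hk2]
  rw [hk2] at hM
  set E : ℕ := ⌈C₀⌉₊ + M with hE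
  set D : ℕ := (k + 1) * (k * k + E * k ^ k) with hD
  have hDpos : 0 < D := by
    have : 0 < k := by omega
    positivity
  -- `D` serves both as the threshold for `n` and as the constant bounding the exceptional family
  -- `R`.
  refine ⟨D, hDpos, D, by exact_mod_cast hDpos, fun n hn H hH hbush hcard => ?_⟩
  set F := (Finset.univ.powersetCard k).filter
    (fun Y : Finset (Fin n) => (extensionCenters H a b K Y).card ≠ s - 1) with hF
  have hFcard : F.card ≤ E * n ^ (k - 1) := by
    have h1 := card_deficient_add_le hK' hbush (show a ≤ k by omega)
    have h2 := card_le_sum_card_extensionCenters (a := a) (b := b) (K := K)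
      (Finset.filter_subset (fun e => ∃ c, IsCenter H a b K e c) H)
      (fun e he => hH e (Finset.mem_filter.1 he).1) (fun e he => (Finset.mem_filter.1 he).2)
    rw [Nat.add_sub_cancel] at h2
    have h3 := hM n H hH hbush (H.filter (fun e => ¬ ∃ c, IsCenter H a b K e c))
      (Finset.filter_subset _ _) (fun e he c hc => (Finset.mem_filter.1 he).2 ⟨c, hc⟩)
    have h4 := Finset.card_filter_add_card_filter_not (s := H)
      (fun e => ∃ c, IsCenter H a b K e c)
    rw [Fintype.card_fin, ← hF] at h1
    have h5 : M * n.choose (k - 1) ≤ M * n ^ (k - 1) := by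
      gcongr
      exact Nat.choose_le_pow _ _
    have h6 : F.card + H.card ≤ (s - 1) * n.choose k + M * n ^ (k - 1) := by omega
    have h7 : (F.card : ℝ) + H.card ≤ ((s : ℝ) - 1) * n.choose k + M * (n : ℝ) ^ (k - 1) := by
      have : ((F.card + H.card : ℕ) : ℝ) ≤ (((s - 1) * n.choose k + M * n ^ (k - 1) : ℕ) : ℝ) :=
        Nat.cast_le.2 h6
      push_cast [Nat.cast_sub hs] at this
      exact this
    have h8 : C₀ * (n : ℝ) ^ (k - 1) ≤ (⌈C₀⌉₊ : ℝ) * (n : ℝ) ^ (k - 1) := by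
      gcongr
      exact Nat.le_ceil _
    have h9 : (F.card : ℝ) ≤ (E : ℝ) * (n : ℝ) ^ (k - 1) := by
      rw [hE]
      push_cast
      linarith
    exact_mod_cast h9
  have hFk : ∀ Y ∈ F, Y.card = k := fun Y hY =>
    (Finset.mem_powersetCard.1 (Finset.mem_filter.1 hY).1).2
  have hfull : ∀ Y : Finset (Fin n), Y.card = k → Y ∉ F →
      (extensionCenters H a b K Y).card = s - 1 := by
    intro Y hY hYF
    by_contra hne
    exact hYF (Finset.mem_filter.2 ⟨Finset.mem_powersetCard.2 ⟨Finset.subset_univ _, hY⟩, hne⟩)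
  -- Neighbouring sets share at least `k - 1 = a + b - 2 ≥ a` vertices, by `2 ≤ b`.
  obtain ⟨Y₀, hY₀, hY₀F, R, hR, hRY⟩ := exists_popular_value (by omega)
    (extensionCenters H a b K) F hFk hFcard
    (fun Y Y' hY hY' hYF hYF' hint => extensionCenters_eq_of_le_card_inter hK' hbush
      (by omega) (hfull Y hY hYF) (hfull Y' hY' hYF')) hn
  refine ⟨extensionCenters H a b K Y₀, hfull Y₀ hY₀ hY₀F, fun v hv => ?_⟩
  have hdeg := choose_le_vertexDegree_add (H := H) (k := k) (v := v) (R := R) (by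
    intro Y hY hYR
    rw [← (hRY Y hY hYR).2, mem_extensionCenters] at hv
    exact ⟨hv.1, hv.2.1⟩)
  rw [Fintype.card_fin] at hdeg
  have hdeg' : n.choose k ≤ vertexDegree H v + D * n ^ (k - 1) := hdeg.trans (Nat.add_le_add_left hR _)
  have : (n.choose k : ℝ) ≤ vertexDegree H v + D * (n : ℝ) ^ (k - 1) := by exact_mod_cast hdeg'
  linarith
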